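/- Let $K/F$ be a cyclic Galois field extension of degree $n>1$ with $\mathrm{Gal}(K/F)=\langle\sigma\rangle$, and let $R=K[t;\sigma]$ be the twisted polynomial ring, with multiplication given by $ta=\sigma(a)t$ for $a\in K$. Call $f\in R$ \emph{right invariant} if the left ideal $Rf$ is two-sided. The \emph{minimal central left multiple} of a monic $f\in R$ is the polynomial $h(t)=\hat h(t^n)$, with $\hat h\in F[x]$ monic, of minimal degree such that $h=gf$ for some $g\in R$; it exists and is unique. Put $m_0=\deg\hat h$. Let $f\in R$ be monic of degree $m$ with minimal central left multiple $h(t)=\hat h(t^n)$. (i) Suppose that $f$ is irreducible in $R$ and not right invariant. If $\gcd(m,n)=1$, then $\deg h=mn$. (ii) Suppose that $m$ is prime, that $f$ is irreducible in $R$ or $\hat h$ is irreducible in $F[x]$, and that $\hat h(x)\neq x+a$ for all $a\in F$. Then $f$ is not right invariant and $\deg h=mn$. In both cases $m_0=m$, and the degree $mn$ is maximal: the minimal central left multiple of every monic polynomial of degree $m$ in $R$ has degree at most $mn$. -/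

import Mathlib

open Polynomial

/-- The field `K`, remembering an automorphism `σ` of `K` over `F`; it serves as the coefficient
field of the twisted polynomial ring `K[t;σ]`. -/
def TwistedCoeff {F K : Type*} [Field F] [Field K] [Algebra F K] (_σ : K ≃ₐ[F] K) : Type _ := K

namespace TwistedCoeff

variable {F K : Type*} [Field F] [Field K] [Algebra F K] (σ : K ≃ₐ[F] K)

noncomputable instance : Field (TwistedCoeff σ) := inferInstanceAs (Field K)

noncomputable instance : Algebra F (TwistedCoeff σ) := inferInstanceAs (Algebra F K)

/-- The natural number `i` acts on the coefficients as `σ ^ i`. -/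
noncomputable instance : MulSemiringAction (Multiplicative ℕ) (TwistedCoeff σ) :=
  MulSemiringAction.compHom K (powersHom (K ≃ₐ[F] K) σ)

/-- The identity map, regarding an element of `K` as a coefficient. -/
def of (a : K) : TwistedCoeff σ := a

theorem ofAdd_smul (i : ℕ) (a : K) : Multiplicative.ofAdd i • of σ a = of σ ((σ ^ i) a) := rfl

end TwistedCoeff

/-- The twisted polynomial ring `K[t;σ]`: polynomials `∑ aᵢ tⁱ` with `aᵢ ∈ K` and `t a = σ(a) t`. -/
abbrev TwistedPolynomial {F K : Type*} [Field F] [Field K] [Algebra F K] (σ : K ≃ₐ[F] K) : Type _ :=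
  SkewPolynomial (TwistedCoeff σ)

namespace TwistedPolynomial

variable {F K : Type*} [Field F] [Field K] [Algebra F K] {σ : K ≃ₐ[F] K}

/-- The commutation rule `t a = σ(a) t`. -/
theorem X_mul_C (a : K) :
    (SkewPolynomial.X : TwistedPolynomial σ) * SkewPolynomial.C (TwistedCoeff.of σ a) =
      SkewPolynomial.C (TwistedCoeff.of σ (σ a)) * SkewPolynomial.X := by
  simp only [← SkewPolynomial.monomial_zero_left, SkewPolynomial.X_mul_monomial,
    SkewPolynomial.monomial_mul_X]
  rfl

/-- The degree of a twisted polynomial in `t` (with value `0` at the zero polynomial). -/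
noncomputable def natDegree (f : TwistedPolynomial σ) : ℕ := f.support.sup id

/-- The leading coefficient is `1`. -/
def Monic (f : TwistedPolynomial σ) : Prop := f.coeff (natDegree f) = 1

/-- `f` is right invariant: the left ideal `R f` of `R = K[t;σ]` is two-sided. -/
def RightInvariant (f : TwistedPolynomial σ) : Prop := (Ideal.span {f}).IsTwoSided

/-- For `p ∈ F[x]`, the element `p(tⁿ)` of `F[tⁿ] ⊆ K[t;σ]`, where `n = [K : F]`. -/
noncomputable def evalTPow (σ : K ≃ₐ[F] K) (p : F[X]) : TwistedPolynomial σ :=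
  p.eval₂ (SkewPolynomial.CRingHom.comp (algebraMap F (TwistedCoeff σ)))
    (SkewPolynomial.X ^ Module.finrank F K)

/-- `p(tⁿ)` is a left multiple `g f` of `f`. -/
def IsCentralLeftMultiple (f : TwistedPolynomial σ) (p : F[X]) : Prop :=
  ∃ g : TwistedPolynomial σ, evalTPow σ p = g * f

/-- The minimal central left multiple of `f` is `h(t) = ĥ(tⁿ)`: `ĥ ∈ F[x]` is monic, `ĥ(tⁿ)` is a
left multiple of `f`, and its degree in `t` is minimal with these properties. -/
structure IsMclm (f : TwistedPolynomial σ) (hhat : F[X]) : Prop where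
  monic : hhat.Monic
  isCentralLeftMultiple : IsCentralLeftMultiple f hhat
  minimal : ∀ p : F[X], p.Monic → IsCentralLeftMultiple f p →
    natDegree (evalTPow σ hhat) ≤ natDegree (evalTPow σ p)

end TwistedPolynomial

/-! Everything is read off from the left module `V = R/Rf`, which by division with remainder has
`K`-dimension `m`. The element `tⁿ` is central, so it acts on `V` `K`-linearly. If `B` is the matrix
of the semilinear action of `t`, then `tⁿ` has matrix `B σ(B) ⋯ σⁿ⁻¹(B)`; applying `σ` rotates the
factors cyclically, so the characteristic polynomial `p` has coefficients in `F`. By Cayley–Hamilton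
`p(tⁿ) ∈ Rf`, whence `deg ĥ ≤ m`.

(i) If `f` is irreducible, `V` is simple. A two-sided ideal in which `t` can be cancelled is
generated by some `q(tⁿ)` (`exists_evalTPow_eq_of_isMinMonic`); for the annihilator `J` of `V`
minimality gives `deg q = deg ĥ`. Moreover `R/J` is a finite power `V^k`, so counting `K`-dimensions
gives `n · deg ĥ = k · m`. If `gcd(m, n) = 1`, then `m ∣ deg ĥ`, and the upper bound gives equality.

(ii) `p` divides a power of every annihilating polynomial, in particular of `ĥ`. If `ĥ` is
irreducible, which irreducibility of `f` implies, `p` is a power of `ĥ` and `deg ĥ ∣ m`. For `m`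
prime and `ĥ` not linear this forces `deg ĥ = m`. An invariant `f` with `ĥ(0) ≠ 0` would itself be
some `q(tⁿ)`, giving `n · m ≤ m`, which is absurd. -/

namespace SkewPolynomial

/-! ### Coefficients of sums and products. -/

section Additive

variable {L : Type*} [Field L]

theorem coeff_smul_apply {S : Type*} [SMulZeroClass S L] (a : S) (r : SkewPolynomial L) (i : ℕ) :
    (a • r).coeff i = a • r.coeff i := by
  simp [coeff, SkewMonoidAlgebra.coeff_smul]

theorem coeff_finsetSum {ι : Type*} (s : Finset ι) (r : ι → SkewPolynomial L) (i : ℕ) :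
    (∑ j ∈ s, r j).coeff i = ∑ j ∈ s, (r j).coeff i := by
  classical
  induction s using Finset.induction with
  | empty => simp
  | insert a s ha ih => rw [Finset.sum_insert ha, Finset.sum_insert ha, coeff_add, ih]

end Additive

section Coeff

variable {L : Type*} [Field L] [MulSemiringAction (Multiplicative ℕ) L]

theorem C_mul_eq_smul (a : L) (r : SkewPolynomial L) : C a * r = a • r := by
  have h : C a = a • (1 : SkewPolynomial L) := by
    rw [← C_1, ← monomial_zero_left, ← monomial_zero_left, smul_monomial, smul_eq_mul, mul_one]
  rw [h, smul_mul_assoc, one_mul]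

theorem coeff_mul_eq_sum (p q : SkewPolynomial L) (k : ℕ) :
    (p * q).coeff k = ∑ x ∈ Finset.HasAntidiagonal.antidiagonal k,
      p.coeff x.1 * φ^[x.1] (q.coeff x.2) := by
  have key := SkewMonoidAlgebra.coeff_mul_antidiagonal_of_finset p q (Multiplicative.ofAdd k)
    ((Finset.HasAntidiagonal.antidiagonal k).map
      (Equiv.prodCongr Multiplicative.ofAdd Multiplicative.ofAdd).toEmbedding) (by
      rintro ⟨a, b⟩
      simp only [Finset.mem_map_equiv, Finset.HasAntidiagonal.mem_antidiagonal]
      exact Iff.rfl)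
  rw [Finset.sum_map] at key
  refine key.trans (Finset.sum_congr rfl fun x _ => ?_)
  rw [φ_iterate_apply]
  rfl

theorem coeff_mul_C (r : SkewPolynomial L) (a : L) (i : ℕ) :
    (r * C a).coeff i = r.coeff i * φ^[i] a := by
  rw [coeff_mul_eq_sum, Finset.sum_eq_single (i, 0)]
  · simp
  · rintro ⟨j, k⟩ hjk hne
    have hk : k ≠ 0 := by
      rintro rfl
      simp at hjk
      exact hne (by simp [hjk])
    simp [coeff_C_ne_zero hk]
  · simp

theorem coeff_monomial_mul_add (k : ℕ) (a : L) (r : SkewPolynomial L) (i : ℕ) :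
    (monomial k a * r).coeff (k + i) = a * φ^[k] (r.coeff i) := by
  rw [coeff_mul_eq_sum, Finset.sum_eq_single (k, i)]
  · simp [coeff_monomial]
  · rintro ⟨j, l⟩ hjl hne
    have hk : k ≠ j := by
      rintro rfl
      simp at hjl
      exact hne (by simp [hjl])
    simp [coeff_monomial, hk]
  · simp

theorem coeff_monomial_mul_of_lt (k : ℕ) (a : L) (r : SkewPolynomial L) {i : ℕ} (h : i < k) :
    (monomial k a * r).coeff i = 0 := by
  rw [coeff_mul_eq_sum]
  refine Finset.sum_eq_zero ?_
  rintro ⟨j, l⟩ hjl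
  have hk : k ≠ j := by
    rintro rfl
    simp at hjl
    omega
  simp [coeff_monomial, hk]

theorem coeff_X_mul_succ (r : SkewPolynomial L) (i : ℕ) :
    (X * r).coeff (i + 1) = φ (r.coeff i) := by
  rw [← monomial_one_one_eq_X, add_comm, coeff_monomial_mul_add]
  simp

theorem coeff_X_mul_zero (r : SkewPolynomial L) : (X * r).coeff 0 = 0 := by
  rw [← monomial_one_one_eq_X, coeff_monomial_mul_of_lt _ _ _ one_pos]

theorem coeff_mul_X_succ (r : SkewPolynomial L) (i : ℕ) :
    (r * X).coeff (i + 1) = r.coeff i := by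
  rw [coeff_mul_eq_sum, Finset.sum_eq_single (i, 1)]
  · simp
  · rintro ⟨j, l⟩ hjl hne
    have hl : l ≠ 1 := by
      rintro rfl
      simp at hjl
      exact hne (by simp [hjl])
    simp [coeff_X_of_ne_one hl]
  · simp

theorem coeff_mul_X_zero (r : SkewPolynomial L) : (r * X).coeff 0 = 0 := by
  rw [coeff_mul_eq_sum]
  simp

end Coeff

/-! ### Degree, right division and left ideals. -/

section Degree

variable (L : Type*) [Field L]

/-- The skew polynomials of degree less than `d`. -/
def degreeLT (d : ℕ) : Submodule L (SkewPolynomial L) where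
  carrier := {r | ∀ i, d ≤ i → r.coeff i = 0}
  zero_mem' := by simp
  add_mem' ha hb i hi := by simp [ha i hi, hb i hi]
  smul_mem' a r hr i hi := by
    simp [coeff_smul_apply, hr i hi]

variable {L}

theorem degreeLT_mono {d e : ℕ} (h : d ≤ e) : degreeLT L d ≤ degreeLT L e :=
  fun _ hr i hi => hr i (h.trans hi)

theorem exists_mem_degreeLT (r : SkewPolynomial L) : ∃ d, r ∈ degreeLT L d := by
  refine ⟨r.support.sup id + 1, fun i hi => ?_⟩
  rw [← notMem_support_iff]
  intro h
  have := Finset.le_sup (f := id) h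
  simp only [id] at this
  omega

theorem eq_zero_of_mem_degreeLT_zero {r : SkewPolynomial L} (h : r ∈ degreeLT L 0) : r = 0 := by
  ext i
  simpa using h i (Nat.zero_le i)

theorem mem_degreeLT_of_succ {d : ℕ} {r : SkewPolynomial L} (h : r ∈ degreeLT L (d + 1))
    (h0 : r.coeff d = 0) : r ∈ degreeLT L d := by
  intro i hi
  rcases hi.eq_or_lt with rfl | hi
  · exact h0
  · exact h i hi

theorem exists_coeff_ne_zero {r : SkewPolynomial L} (h : r ≠ 0) :
    ∃ d, r ∈ degreeLT L (d + 1) ∧ r.coeff d ≠ 0 := by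
  classical
  have hex := exists_mem_degreeLT r
  obtain ⟨e, he⟩ : ∃ e, Nat.find hex = e := ⟨_, rfl⟩
  have hmem := Nat.find_spec hex
  rw [he] at hmem
  cases e with
  | zero => exact absurd (eq_zero_of_mem_degreeLT_zero hmem) h
  | succ e =>
    refine ⟨e, hmem, fun h0 => Nat.find_min hex (m := e) (by omega) (mem_degreeLT_of_succ hmem h0)⟩

/-- Skew polynomials of degree less than `d` are determined by `d` coefficients. -/
noncomputable def degreeLTEquiv (d : ℕ) : degreeLT L d ≃ₗ[L] (Fin d → L) where
  toFun r i := r.1.coeff i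
  map_add' r s := by ext; simp
  map_smul' a r := by
    ext
    simp [coeff, SkewMonoidAlgebra.coeff_smul]
  invFun v := ⟨∑ i : Fin d, monomial (i : ℕ) (v i), Submodule.sum_mem _ fun i _ j hj => by
    rw [coeff_monomial, if_neg (by omega)]⟩
  left_inv r := by
    ext j
    simp only [coeff_finsetSum, coeff_monomial]
    by_cases hj : j < d
    · rw [Finset.sum_eq_single ⟨j, hj⟩]
      · simp
      · intro b _ hb
        rw [if_neg]
        rintro rfl
        exact hb rfl
      · simp
    · rw [r.2 j (by omega)]
      refine Finset.sum_eq_zero fun i _ => ?_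
      rw [if_neg (by omega)]
  right_inv v := by
    ext j
    simp only [coeff_finsetSum, coeff_monomial]
    rw [Finset.sum_eq_single j]
    · simp
    · intro b _ hb
      rw [if_neg]
      exact fun h => hb (Fin.ext h)
    · simp

/-- `r` is monic of degree `d`. -/
structure IsMonicOfDegree (r : SkewPolynomial L) (d : ℕ) : Prop where
  mem : r ∈ degreeLT L (d + 1)
  coeff : r.coeff d = 1

variable [MulSemiringAction (Multiplicative ℕ) L]

theorem coeff_mul_add_of_mem {p q : SkewPolynomial L} {k d : ℕ} (hp : p ∈ degreeLT L (k + 1))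
    (hq : q ∈ degreeLT L (d + 1)) : (p * q).coeff (k + d) = p.coeff k * φ^[k] (q.coeff d) := by
  rw [coeff_mul_eq_sum, Finset.sum_eq_single (k, d)]
  · rintro ⟨i, j⟩ hij hne
    simp only [Finset.HasAntidiagonal.mem_antidiagonal] at hij
    rcases Nat.lt_or_ge k i with h | h
    · simp [hp i h]
    · have hj : d + 1 ≤ j := by
        by_contra hj
        apply hne
        ext <;> simp <;> omega
      simp [hq j hj]
  · simp

theorem mul_mem_degreeLT {p q : SkewPolynomial L} {k d : ℕ} (hp : p ∈ degreeLT L (k + 1))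
    (hq : q ∈ degreeLT L (d + 1)) : p * q ∈ degreeLT L (k + d + 1) := by
  intro i hi
  rw [coeff_mul_eq_sum]
  refine Finset.sum_eq_zero ?_
  rintro ⟨a, b⟩ hab
  simp only [Finset.HasAntidiagonal.mem_antidiagonal] at hab
  rcases Nat.lt_or_ge k a with h | h
  · simp [hp a h]
  · simp [hq b (by omega)]

/-- Ring endomorphisms fix the leading coefficient `1` of `c`, so `q * c` inherits the leading
coefficient of `q`. -/
theorem IsMonicOfDegree.eq_zero_of_mul_mem {c : SkewPolynomial L} {d : ℕ}
    (hc : IsMonicOfDegree c d) {q : SkewPolynomial L} (h : q * c ∈ degreeLT L d) : q = 0 := by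
  by_contra hq
  obtain ⟨k, hk, hk0⟩ := exists_coeff_ne_zero hq
  have := h (k + d) (by omega)
  rw [coeff_mul_add_of_mem hk hc.mem, hc.coeff] at this
  simp at this
  exact hk0 this

theorem IsMonicOfDegree.exists_sub_mul_mem {c : SkewPolynomial L} {d : ℕ}
    (hc : IsMonicOfDegree c d) (r : SkewPolynomial L) : ∃ q, r - q * c ∈ degreeLT L d := by
  obtain ⟨e, he⟩ := exists_mem_degreeLT r
  induction e generalizing r with
  | zero => exact ⟨0, by simpa using degreeLT_mono (Nat.zero_le d) he⟩
  | succ e ih =>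
    rcases Nat.lt_or_ge e d with h | h
    · exact ⟨0, by simpa using degreeLT_mono h he⟩
    · obtain ⟨k, rfl⟩ := Nat.exists_eq_add_of_le' h
      have hm : monomial k (r.coeff (k + d)) ∈ degreeLT L (k + 1) := by
        intro i hi
        rw [coeff_monomial, if_neg (by omega)]
      obtain ⟨q, hq⟩ := ih (r - monomial k (r.coeff (k + d)) * c) (by
        refine mem_degreeLT_of_succ (Submodule.sub_mem _ he (mul_mem_degreeLT hm hc.mem)) ?_
        rw [coeff_sub, coeff_monomial_mul_add, hc.coeff]
        simp)
      exact ⟨monomial k (r.coeff (k + d)) + q, by rwa [add_mul, ← sub_sub]⟩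

theorem exists_isMonicOfDegree_of_ne_zero {I : Ideal (SkewPolynomial L)} {r : SkewPolynomial L}
    (hr : r ∈ I) (hr0 : r ≠ 0) : ∃ d, ∃ c ∈ I, IsMonicOfDegree c d ∧
      (∀ e, r ∈ degreeLT L (e + 1) → d ≤ e) := by
  obtain ⟨d, hd, hd0⟩ := exists_coeff_ne_zero hr0
  refine ⟨d, C (r.coeff d)⁻¹ * r, I.mul_mem_left _ hr, ⟨?_, ?_⟩, ?_⟩
  · rw [C_mul_eq_smul]
    exact Submodule.smul_mem _ _ hd
  · rw [C_mul_eq_smul, coeff_smul_apply, smul_eq_mul, inv_mul_cancel₀ hd0]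
  · intro e he
    by_contra h
    exact hd0 (he d (by omega))

/-- `c` is a monic element of `I` of least degree `d`. -/
structure IsMinMonic (I : Ideal (SkewPolynomial L)) (c : SkewPolynomial L) (d : ℕ) : Prop where
  mem : c ∈ I
  monic : IsMonicOfDegree c d
  eq_zero : ∀ r ∈ I, r ∈ degreeLT L d → r = 0

theorem exists_isMinMonic {I : Ideal (SkewPolynomial L)} (hI : I ≠ ⊥) :
    ∃ d c, IsMinMonic I c d := by
  classical
  obtain ⟨r, hr, hr0⟩ := Submodule.exists_mem_ne_zero_of_ne_bot hI
  have hex : ∃ d, ∃ c ∈ I, IsMonicOfDegree c d := by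
    obtain ⟨d, c, hc, hcd, -⟩ := exists_isMonicOfDegree_of_ne_zero hr hr0
    exact ⟨d, c, hc, hcd⟩
  obtain ⟨c, hc, hcd⟩ := Nat.find_spec hex
  refine ⟨Nat.find hex, c, hc, hcd, fun s hs hsd => ?_⟩
  by_contra hs0
  obtain ⟨d, c', hc', hcd', hmin⟩ := exists_isMonicOfDegree_of_ne_zero hs hs0
  rcases Nat.eq_zero_or_pos (Nat.find hex) with h | h
  · rw [h] at hsd
    exact hs0 (eq_zero_of_mem_degreeLT_zero hsd)
  · have := hmin (Nat.find hex - 1) (by rwa [Nat.sub_add_cancel h])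
    exact Nat.find_min hex (by omega) ⟨c', hc', hcd'⟩

theorem IsMonicOfDegree.isMinMonic_span {c : SkewPolynomial L} {d : ℕ}
    (hc : IsMonicOfDegree c d) : IsMinMonic (Ideal.span {c}) c d where
  mem := Ideal.mem_span_singleton_self c
  monic := hc
  eq_zero r hr hrd := by
    obtain ⟨q, rfl⟩ := Ideal.mem_span_singleton'.1 hr
    rw [hc.eq_zero_of_mul_mem hrd, zero_mul]

namespace IsMinMonic

variable {I : Ideal (SkewPolynomial L)} {c : SkewPolynomial L} {d : ℕ}

theorem eq_span (h : IsMinMonic I c d) : I = Ideal.span {c} := by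
  refine le_antisymm (fun r hr => ?_) ((Ideal.span_singleton_le_iff_mem I).2 h.mem)
  obtain ⟨q, hq⟩ := h.monic.exists_sub_mul_mem r
  have := h.eq_zero _ (I.sub_mem hr (I.mul_mem_left q h.mem)) hq
  exact Ideal.mem_span_singleton'.2 ⟨q, (sub_eq_zero.1 this).symm⟩

/-- Existence of the remainder on right division by `c` gives the sum; minimality of `d` makes it
direct. -/
theorem isCompl (h : IsMinMonic I c d) : IsCompl (I.restrictScalars L) (degreeLT L d) where
  disjoint := by
    rw [Submodule.disjoint_def]
    exact fun r hr hrd => h.eq_zero r hr hrd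
  codisjoint := by
    rw [codisjoint_iff, eq_top_iff]
    intro r _
    obtain ⟨q, hq⟩ := h.monic.exists_sub_mul_mem r
    exact Submodule.mem_sup.2 ⟨q * c, I.mul_mem_left q h.mem, _, hq, by abel⟩

/-- The quotient by a left ideal has the powers of `X` below the least degree as a basis. -/
noncomputable def quotientEquiv (h : IsMinMonic I c d) :
    (SkewPolynomial L ⧸ I) ≃ₗ[L] (Fin d → L) :=
  (Submodule.Quotient.restrictScalarsEquiv L I).symm.trans
    ((Submodule.quotientEquivOfIsCompl _ _ h.isCompl).trans (degreeLTEquiv d))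

theorem finite_quotient (h : IsMinMonic I c d) : Module.Finite L (SkewPolynomial L ⧸ I) :=
  Module.Finite.equiv h.quotientEquiv.symm

theorem finrank_quotient (h : IsMinMonic I c d) :
    Module.finrank L (SkewPolynomial L ⧸ I) = d := by
  rw [h.quotientEquiv.finrank_eq, Module.finrank_fin_fun]

end IsMinMonic

theorem IsMonicOfDegree.eq_one_of_zero {c : SkewPolynomial L} (hc : IsMonicOfDegree c 0) :
    c = 1 := by
  ext i
  rw [coeff_one]
  rcases Nat.eq_zero_or_pos i with rfl | h
  · simp [hc.coeff]
  · rw [hc.mem i h, if_neg h.ne]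

/-- A monic irreducible skew polynomial generates a maximal left ideal. -/
theorem isSimpleModule_quotient_span {f : SkewPolynomial L} {m : ℕ} (hf : IsMonicOfDegree f m)
    (hirr : Irreducible f) :
    IsSimpleModule (SkewPolynomial L) (SkewPolynomial L ⧸ Ideal.span {f}) := by
  rw [isSimpleModule_iff_isCoatom]
  refine ⟨fun htop => ?_, fun J hJ => ?_⟩
  · have h1 : (1 : SkewPolynomial L) ∈ Ideal.span {f} := htop ▸ Submodule.mem_top
    rcases Nat.eq_zero_or_pos m with rfl | hm
    · exact hirr.not_isUnit (hf.eq_one_of_zero ▸ isUnit_one)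
    · refine one_ne_zero (hf.isMinMonic_span.eq_zero 1 h1 fun i hi => ?_)
      rw [coeff_one, if_neg (by omega)]
  · obtain ⟨d, g, hg⟩ := exists_isMinMonic (ne_bot_of_gt hJ)
    have hfJ : f ∈ J := hJ.le (Ideal.mem_span_singleton_self f)
    rw [hg.eq_span] at hfJ
    obtain ⟨r, hr⟩ := Ideal.mem_span_singleton'.1 hfJ
    -- Here `J = Rg` and `f = r g`: a unit `r` would give `J = Rf`, a unit `g` gives `J = R`.
    rcases hirr.isUnit_or_isUnit hr.symm with hu | hu
    · exfalso
      obtain ⟨u, rfl⟩ := hu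
      refine hJ.not_ge ?_
      rw [hg.eq_span, Ideal.span_singleton_le_iff_mem]
      exact Ideal.mem_span_singleton'.2 ⟨↑u⁻¹, by rw [← hr, Units.inv_mul_cancel_left]⟩
    · exact Ideal.eq_top_of_isUnit_mem _ hg.mem hu

end Degree

end SkewPolynomial

/-! ### Twisted powers of a matrix and their characteristic polynomials. -/

section TwistedPower

variable {L ι : Type*} [CommRing L] [Fintype ι] [DecidableEq ι]

/-- The twisted power `B * φ(B) * ⋯ * φ^(k-1)(B)`. -/
noncomputable def Matrix.twistedPow (φ : L →+* L) (B : Matrix ι ι L) : ℕ → Matrix ι ι L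
  | 0 => 1
  | k + 1 => B * φ.mapMatrix (Matrix.twistedPow φ B k)

/-- Splitting off the last factor instead of the first is what makes the cyclic rotation of the
factors visible. -/
theorem Matrix.twistedPow_succ' (φ : L →+* L) (B : Matrix ι ι L) (k : ℕ) :
    B.twistedPow φ (k + 1) = B.twistedPow φ k * φ.mapMatrix^[k] B := by
  induction k with
  | zero => simp [twistedPow]
  | succ k ih =>
    rw [twistedPow, ih, map_mul, ← mul_assoc, Function.iterate_succ_apply', ← ih]
    rfl

theorem RingHom.iterate_mapMatrix_apply (φ : L →+* L) (B : Matrix ι ι L) (k : ℕ) (i j : ι) :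
    (φ.mapMatrix^[k] B) i j = φ^[k] (B i j) := by
  induction k with
  | zero => rfl
  | succ k ih =>
    rw [Function.iterate_succ_apply', Function.iterate_succ_apply', ← ih]
    rfl

/-- If `φ^n = 1`, the characteristic polynomial of `B * φ(B) * ⋯ * φ^(n-1)(B)` is fixed by `φ`. -/
theorem Matrix.map_charpoly_twistedPow (φ : L →+* L) (B : Matrix ι ι L) (n : ℕ)
    (hφ : ∀ a, φ^[n] a = a) :
    (B.twistedPow φ n).charpoly.map φ = (B.twistedPow φ n).charpoly := by
  cases n with
  | zero => simp [twistedPow, ← Matrix.charpoly_map]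
  | succ k =>
    -- Applying `φ` moves the first factor `B` to the end, because the last factor `φ^k(B)` becomes
    -- `B`; then `charpoly (M * N) = charpoly (N * M)`.
    have hB : φ.mapMatrix (φ.mapMatrix^[k] B) = B := by
      rw [← Function.iterate_succ_apply' φ.mapMatrix]
      ext i j
      rw [RingHom.iterate_mapMatrix_apply, hφ]
    rw [← Matrix.charpoly_map, ← RingHom.mapMatrix_apply, twistedPow_succ', map_mul, hB,
      Matrix.charpoly_mul_comm, ← twistedPow, twistedPow_succ']

end TwistedPower

namespace SkewPolynomial

variable {L V : Type*} [Field L] [MulSemiringAction (Multiplicative ℕ) L] [AddCommGroup V]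
  [Module (SkewPolynomial L) V] [Module L V] [IsScalarTower L (SkewPolynomial L) V]

theorem C_smul (a : L) (v : V) : (C a : SkewPolynomial L) • v = a • v := by
  rw [← mul_one (C a), C_mul_eq_smul, smul_assoc, one_smul]

theorem X_smul_smul (a : L) (v : V) :
    (X : SkewPolynomial L) • a • v = φ a • (X : SkewPolynomial L) • v := by
  rw [← C_smul, ← C_smul, smul_smul, smul_smul, C_mul_X_eq_monomial, ← monomial_zero_left,
    X_mul_monomial]

/-- `X` acts `φ`-semilinearly, so each further application multiplies by its matrix on the left and
twists everything else by `φ`. -/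
theorem repr_X_pow_smul {ι : Type*} [Fintype ι] [DecidableEq ι] (b : Module.Basis ι L V) (k : ℕ)
    (v : V) : (b.repr ((X : SkewPolynomial L) ^ k • v) : ι → L) =
      ((Matrix.of fun i j => b.repr ((X : SkewPolynomial L) • b j) i).twistedPow φ k).mulVec
        fun i => φ^[k] (b.repr v i) := by
  induction k with
  | zero => simp [Matrix.twistedPow]
  | succ k ih =>
    have hX : ∀ w : V, (b.repr ((X : SkewPolynomial L) • w) : ι → L) =
        (Matrix.of fun i j => b.repr ((X : SkewPolynomial L) • b j) i).mulVec
          fun i => φ (b.repr w i) := by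
      intro w
      conv_lhs => rw [← b.sum_repr w, Finset.smul_sum]
      ext i
      simp only [X_smul_smul, map_sum, map_smul, Finsupp.coe_finsetSum, Finset.sum_apply,
        Finsupp.smul_apply, Matrix.mulVec, dotProduct, Matrix.of_apply, smul_eq_mul]
      exact Finset.sum_congr rfl fun j _ => mul_comm _ _
    rw [pow_succ', mul_smul, hX, Matrix.twistedPow, ← Matrix.mulVec_mulVec]
    congr 1
    ext i
    rw [ih, RingHom.map_mulVec]
    simp only [RingHom.mapMatrix_apply, Function.iterate_succ_apply']
    rfl

end SkewPolynomial

/-! ### The central subring `F[tⁿ]` and the action of `tⁿ` on modules. -/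

namespace TwistedPolynomial

open SkewPolynomial

variable {F K : Type*} [Field F] [Field K] [Algebra F K] (σ : K ≃ₐ[F] K)

theorem phi_iterate (i : ℕ) (a : TwistedCoeff σ) :
    (φ^[i] a : TwistedCoeff σ) = (show TwistedCoeff σ from (σ ^ i) (show K from a)) :=
  φ_iterate_apply i a

theorem phi_eq (a : TwistedCoeff σ) :
    (φ a : TwistedCoeff σ) = (show TwistedCoeff σ from σ (show K from a)) := by
  have := phi_iterate σ 1 a
  simpa using this

theorem phi_algebraMap (b : F) :
    φ (algebraMap F (TwistedCoeff σ) b) = algebraMap F (TwistedCoeff σ) b := by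
  rw [phi_eq]
  exact σ.commutes b

theorem phi_iterate_algebraMap (i : ℕ) (b : F) :
    φ^[i] (algebraMap F (TwistedCoeff σ) b) = algebraMap F (TwistedCoeff σ) b :=
  Function.iterate_fixed (phi_algebraMap σ b) i

theorem commute_C_algebraMap (b : F) (r : TwistedPolynomial σ) :
    Commute (SkewPolynomial.C (algebraMap F (TwistedCoeff σ) b)) r := by
  ext i
  rw [C_mul_eq_smul, coeff_smul_apply, SkewPolynomial.coeff_mul_C, phi_iterate_algebraMap, smul_eq_mul, mul_comm]

theorem evalTPow_add (p q : F[X]) : evalTPow σ (p + q) = evalTPow σ p + evalTPow σ q :=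
  Polynomial.eval₂_add _ _

theorem evalTPow_mul (p q : F[X]) : evalTPow σ (p * q) = evalTPow σ p * evalTPow σ q :=
  Polynomial.eval₂_mul_noncomm _ _ fun _ => commute_C_algebraMap σ _ _

theorem evalTPow_monomial (k : ℕ) (b : F) : evalTPow σ (Polynomial.monomial k b) =
    SkewPolynomial.monomial (Module.finrank F K * k) (algebraMap F (TwistedCoeff σ) b) := by
  rw [evalTPow, Polynomial.eval₂_monomial, ← pow_mul, RingHom.comp_apply, CRingHom_eq_C,
    SkewPolynomial.C_mul_X_pow_eq_monomial]

variable {σ} in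
theorem natDegree_eq_of_isMonicOfDegree {f : TwistedPolynomial σ} {d : ℕ}
    (hf : IsMonicOfDegree f d) : natDegree f = d := by
  refine le_antisymm (Finset.sup_le fun i hi => ?_) (Finset.le_sup (f := id) ?_)
  · by_contra h
    rw [SkewPolynomial.mem_support_iff] at hi
    exact hi (hf.mem i (by simp at h; omega))
  · rw [SkewPolynomial.mem_support_iff, hf.coeff]
    exact one_ne_zero

variable {σ} in
theorem Monic.isMonicOfDegree {f : TwistedPolynomial σ} (hf : Monic f) :
    IsMonicOfDegree f (natDegree f) where
  mem i hi := by
    rw [← SkewPolynomial.notMem_support_iff]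
    intro h
    have : i ≤ natDegree f := Finset.le_sup (f := id) h
    omega
  coeff := hf

instance [FiniteDimensional F K] : FiniteDimensional F (TwistedCoeff σ) :=
  inferInstanceAs (FiniteDimensional F K)

variable [FiniteDimensional F K]

theorem coeff_evalTPow (p : F[X]) (j : ℕ) : (evalTPow σ p).coeff j =
    if Module.finrank F K ∣ j then algebraMap F (TwistedCoeff σ) (p.coeff (j / Module.finrank F K))
    else 0 := by
  have hn : 0 < Module.finrank F K := Module.finrank_pos
  induction p using Polynomial.induction_on' with
  | add p q hp hq =>
    rw [evalTPow_add, SkewPolynomial.coeff_add, hp, hq]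
    split_ifs <;> simp
  | monomial k b =>
    rw [evalTPow_monomial, SkewPolynomial.coeff_monomial]
    by_cases h : Module.finrank F K ∣ j
    · obtain ⟨i, rfl⟩ := h
      rw [if_pos (dvd_mul_right _ _), Nat.mul_div_cancel_left _ hn, Polynomial.coeff_monomial]
      simp only [Nat.mul_right_inj hn.ne']
      split_ifs <;> simp
    · rw [if_neg h, if_neg]
      rintro rfl
      exact h (dvd_mul_right _ _)

theorem evalTPow_mem_degreeLT (p : F[X]) :
    evalTPow σ p ∈ SkewPolynomial.degreeLT (TwistedCoeff σ) (Module.finrank F K * p.natDegree + 1) := by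
  intro j hj
  rw [coeff_evalTPow]
  split_ifs with h
  · obtain ⟨i, rfl⟩ := h
    rw [Nat.mul_div_cancel_left _ Module.finrank_pos, Polynomial.coeff_eq_zero_of_natDegree_lt,
      map_zero]
    exact Nat.lt_of_mul_lt_mul_left (a := Module.finrank F K) (by omega)
  · rfl

theorem evalTPow_isMonicOfDegree {p : F[X]} (hp : p.Monic) :
    IsMonicOfDegree (evalTPow σ p) (Module.finrank F K * p.natDegree) where
  mem := evalTPow_mem_degreeLT σ p
  coeff := by
    rw [coeff_evalTPow, if_pos (dvd_mul_right _ _), Nat.mul_div_cancel_left _ Module.finrank_pos,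
      hp.coeff_natDegree, map_one]

variable {σ} in
theorem natDegree_evalTPow {p : F[X]} (hp : p.Monic) :
    natDegree (evalTPow σ p) = Module.finrank F K * p.natDegree :=
  natDegree_eq_of_isMonicOfDegree (evalTPow_isMonicOfDegree σ hp)

variable [IsGalois F K]

theorem phi_iterate_finrank (a : TwistedCoeff σ) : φ^[Module.finrank F K] a = a := by
  rw [phi_iterate, ← IsGalois.card_aut_eq_finrank, pow_card_eq_one']
  rfl

variable {σ}

theorem exists_algebraMap_eq (hσ : ∀ τ : K ≃ₐ[F] K, τ ∈ Subgroup.zpowers σ)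
    {a : TwistedCoeff σ} (ha : φ a = a) : ∃ b : F, algebraMap F (TwistedCoeff σ) b = a := by
  have hK : (show K from a) ∈ (⊥ : IntermediateField F K) := by
    rw [IsGalois.mem_bot_iff_fixed]
    intro τ
    have hle : Subgroup.zpowers σ ≤ MulAction.stabilizer (K ≃ₐ[F] K) (show K from a) := by
      rw [Subgroup.zpowers_le, MulAction.mem_stabilizer_iff]
      rw [phi_eq] at ha
      exact ha
    exact hle (hσ τ)
  obtain ⟨b, hb⟩ := IntermediateField.mem_bot.1 hK
  exact ⟨b, hb⟩

/-- The generator `σ` has order `|Gal(K/F)| = [K : F]`. -/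
theorem modEq_of_phi_iterate_eq (hσ : ∀ τ : K ≃ₐ[F] K, τ ∈ Subgroup.zpowers σ) {i j : ℕ}
    (h : ∀ a : TwistedCoeff σ, φ^[i] a = φ^[j] a) : i ≡ j [MOD Module.finrank F K] := by
  have hpow : σ ^ i = σ ^ j := by
    ext a
    have := h (TwistedCoeff.of σ a)
    exact (phi_iterate σ i _).symm.trans (this.trans (phi_iterate σ j _))
  rwa [pow_eq_pow_iff_modEq, orderOf_eq_card_of_forall_mem_zpowers hσ,
    IsGalois.card_aut_eq_finrank] at hpow

variable (σ)

theorem commute_X_pow_finrank (r : TwistedPolynomial σ) :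
    Commute (SkewPolynomial.X ^ Module.finrank F K) r := by
  change _ * _ = _ * _
  rw [SkewPolynomial.X_pow_mul]
  simp [phi_iterate_finrank]

theorem evalTPow_commute (p : F[X]) (r : TwistedPolynomial σ) : Commute (evalTPow σ p) r := by
  induction p using Polynomial.induction_on' with
  | add p q hp hq =>
    rw [evalTPow_add]
    exact hp.add_left hq
  | monomial k b =>
    rw [evalTPow_monomial, ← SkewPolynomial.C_mul_X_pow_eq_monomial, pow_mul]
    exact (commute_C_algebraMap σ b r).mul_left ((commute_X_pow_finrank σ r).pow_left k)

section Module

variable (V : Type*) [AddCommGroup V] [Module (TwistedPolynomial σ) V]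
  [Module (TwistedCoeff σ) V] [IsScalarTower (TwistedCoeff σ) (TwistedPolynomial σ) V]

/-- The action of the central element `tⁿ`, as a `K`-linear map. -/
noncomputable def tPowEnd : V →ₗ[TwistedCoeff σ] V where
  toFun v := (SkewPolynomial.X ^ Module.finrank F K : TwistedPolynomial σ) • v
  map_add' := smul_add _
  map_smul' a v := by
    rw [← C_smul, smul_smul, (commute_X_pow_finrank σ _).eq, mul_smul, C_smul]
    rfl

theorem tPowEnd_apply (v : V) :
    tPowEnd σ V v = (SkewPolynomial.X ^ Module.finrank F K : TwistedPolynomial σ) • v := rfl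

theorem aeval_tPowEnd (p : F[X]) (v : V) :
    aeval (tPowEnd σ V) (p.map (algebraMap F (TwistedCoeff σ))) v = evalTPow σ p • v := by
  have hpow : ∀ (k : ℕ) (w : V), (tPowEnd σ V ^ k) w =
      ((SkewPolynomial.X ^ Module.finrank F K : TwistedPolynomial σ) ^ k) • w := by
    intro k w
    induction k with
    | zero => simp
    | succ k ih => rw [pow_succ', pow_succ', Module.End.mul_apply, ih, tPowEnd_apply, mul_smul]
  induction p using Polynomial.induction_on' with
  | add p q hp hq =>
    rw [Polynomial.map_add, map_add, LinearMap.add_apply, hp, hq, evalTPow_add,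
      add_smul]
  | monomial k b =>
    rw [Polynomial.map_monomial, Polynomial.aeval_monomial, evalTPow_monomial,
      ← SkewPolynomial.C_mul_X_pow_eq_monomial, pow_mul, mul_smul, C_smul, ← hpow, Module.End.mul_apply,
      Module.algebraMap_end_apply]

variable [Module.Finite (TwistedCoeff σ) V]

/-- The characteristic polynomial of `tⁿ` has coefficients in `F`. -/
theorem exists_map_eq_charpoly (hσ : ∀ τ : K ≃ₐ[F] K, τ ∈ Subgroup.zpowers σ) :
    ∃ p : F[X], p.Monic ∧ p.natDegree = Module.finrank (TwistedCoeff σ) V ∧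
      p.map (algebraMap F (TwistedCoeff σ)) = (tPowEnd σ V).charpoly := by
  have hfix : (tPowEnd σ V).charpoly.map φ = (tPowEnd σ V).charpoly := by
    have b := Module.finBasis (TwistedCoeff σ) V
    -- The twist `φⁿ` on coordinates is trivial, so the twisted power is the matrix of a genuinely
    -- linear map.
    have hmat : LinearMap.toMatrix b b (tPowEnd σ V) = (Matrix.of fun i j =>
        b.repr ((SkewPolynomial.X : TwistedPolynomial σ) • b j) i).twistedPow φ (Module.finrank F K) := by
      ext i j
      rw [LinearMap.toMatrix_apply, tPowEnd_apply, repr_X_pow_smul]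
      simp only [phi_iterate_finrank]
      simp [Finsupp.single_eq_pi_single]
    rw [← LinearMap.charpoly_toMatrix _ b, hmat, Matrix.map_charpoly_twistedPow]
    exact phi_iterate_finrank σ
  have hlift : (tPowEnd σ V).charpoly ∈ Polynomial.lifts (algebraMap F (TwistedCoeff σ)) := by
    rw [Polynomial.lifts_iff_coeff_lifts]
    intro i
    refine exists_algebraMap_eq hσ ?_
    conv_rhs => rw [← hfix]
    rw [Polynomial.coeff_map]
  obtain ⟨p, hp⟩ := (Polynomial.mem_lifts _).1 hlift
  have hinj := (algebraMap F (TwistedCoeff σ)).injective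
  refine ⟨p, ?_, ?_, hp⟩
  · rw [← Polynomial.monic_map_iff (f := algebraMap F (TwistedCoeff σ)), hp]
    exact LinearMap.charpoly_monic _
  · rw [← Polynomial.natDegree_map_eq_of_injective hinj, hp, LinearMap.charpoly_natDegree]

end Module

end TwistedPolynomial

/-! ### Characteristic polynomials and annihilating polynomials. -/

section Charpoly

theorem Commute.sub_dvd_aeval_sub_aeval {L A : Type*} [CommRing L] [Ring A] [Algebra L A] {x y : A}
    (h : Commute x y) (q : L[X]) : x - y ∣ aeval x q - aeval y q := by
  induction q using Polynomial.induction_on' with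
  | add p q hp hq =>
    rw [map_add, map_add, add_sub_add_comm]
    exact dvd_add hp hq
  | monomial k a =>
    obtain ⟨c, hc⟩ := h.sub_dvd_pow_sub_pow k
    refine ⟨a • c, ?_⟩
    rw [aeval_monomial, aeval_monomial, ← Algebra.smul_def, ← Algebra.smul_def, ← smul_sub, hc,
      mul_smul_comm]

/-- The characteristic polynomial divides a power of any annihilating polynomial. -/
theorem Matrix.charpoly_dvd_pow_card {L ι : Type*} [CommRing L] [Fintype ι] [DecidableEq ι]
    (A : Matrix ι ι L) {q : L[X]} (hq : aeval A q = 0) : A.charpoly ∣ q ^ Fintype.card ι := by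
  have hcomm : Commute (algebraMap L[X] (Matrix ι ι L[X]) X) ((CAlgHom (R := L)).mapMatrix A) :=
    Algebra.commutes _ _
  -- Over `L[X]`, the matrix `X·1 - A` divides `q(X)·1 - q(A) = q(X)·1`; the claim is the
  -- determinant of this factorisation.
  obtain ⟨c, hc⟩ := hcomm.sub_dvd_aeval_sub_aeval q
  rw [Polynomial.aeval_algebraMap_apply, aeval_X_left_apply, Polynomial.aeval_algHom_apply, hq,
    map_zero, sub_zero] at hc
  have hdet := congr_arg Matrix.det hc
  rw [Matrix.det_mul, Matrix.algebraMap_eq_diagonal, Matrix.det_diagonal] at hdet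
  refine ⟨c.det, ?_⟩
  simp only [Pi.algebraMap_apply, Algebra.algebraMap_self, RingHom.id_apply, Finset.prod_const,
    Finset.card_univ] at hdet
  exact hdet

theorem LinearMap.charpoly_dvd_pow_finrank {L V : Type*} [Field L] [AddCommGroup V] [Module L V]
    [FiniteDimensional L V] (T : V →ₗ[L] V) {q : L[X]} (hq : aeval T q = 0) :
    T.charpoly ∣ q ^ Module.finrank L V := by
  have b := Module.finBasis L V
  have hA : aeval (LinearMap.toMatrix b b T) q = 0 := by
    have := Polynomial.aeval_algHom_apply (LinearMap.toMatrixAlgEquiv b).toAlgHom T q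
    rw [hq, map_zero] at this
    exact this
  have := (LinearMap.toMatrix b b T).charpoly_dvd_pow_card hA
  rwa [LinearMap.charpoly_toMatrix, Fintype.card_fin] at this

end Charpoly

/-! ### The ring modulo the annihilator of a simple module. -/

section Isotypic

/-- If finitely many vectors of a simple module `V` detect its annihilator, the quotient of the
ring by the annihilator is a finite power of `V`. -/
theorem exists_quotient_annihilator_equiv {R V ι : Type*} [Ring R] [AddCommGroup V] [Module R V]
    [IsSimpleModule R V] [Finite ι] (w : ι → V)
    (hw : ∀ r : R, (∀ i, r • w i = 0) → ∀ v : V, r • v = 0) :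
    ∃ k : ℕ, Nonempty ((R ⧸ Module.annihilator R V) ≃ₗ[R] (Fin k → V)) := by
  set Φ : R →ₗ[R] (ι → V) := LinearMap.pi fun i => LinearMap.toSpanSingleton R V (w i) with hΦ
  have hker : LinearMap.ker Φ = Module.annihilator R V := by
    ext r
    rw [LinearMap.mem_ker, Module.mem_annihilator]
    refine ⟨fun h => hw r fun i => congr_fun h i, fun h => ?_⟩
    ext i
    exact h (w i)
  -- Some coordinate projection is nonzero on a simple submodule, hence an isomorphism onto `V` by
  -- Schur's lemma.
  have hiso : IsIsotypicOfType R (ι → V) V := by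
    intro N _
    obtain ⟨x, hx⟩ := @exists_ne N (IsSimpleModule.nontrivial R N) 0
    obtain ⟨i, hi⟩ : ∃ i, x.1 i ≠ 0 := by
      by_contra! h
      exact hx (Subtype.ext (funext h))
    refine ⟨LinearEquiv.ofBijective ((LinearMap.proj i).comp N.subtype) ?_⟩
    refine (LinearMap.bijective_or_eq_zero _).resolve_right fun h0 => hi ?_
    exact LinearMap.congr_fun h0 x
  have e := (Submodule.quotEquivOfEq _ _ hker.symm).trans Φ.quotKerEquivRange
  have inj : Function.Injective ((LinearMap.range Φ).subtype.comp e.toLinearMap) :=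
    (LinearMap.range Φ).subtype_injective.comp e.injective
  have : IsSemisimpleModule R (R ⧸ Module.annihilator R V) :=
    IsSemisimpleModule.of_injective _ inj
  exact (hiso.of_injective _ inj).linearEquiv_fun

end Isotypic

/-! ### Cancelling `t`, and central generators of two-sided ideals. -/

namespace TwistedPolynomial

open SkewPolynomial

variable {F K : Type*} [Field F] [Field K] [Algebra F K] {σ : K ≃ₐ[F] K}

theorem exists_X_mul_eq_mul_X (r : TwistedPolynomial σ) :
    ∃ r' : TwistedPolynomial σ, SkewPolynomial.X * r = r' * SkewPolynomial.X :=
  ⟨_, SkewPolynomial.X_mul⟩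

theorem rightInvariant_X : RightInvariant (SkewPolynomial.X : TwistedPolynomial σ) := by
  refine ⟨fun b ha => ?_⟩
  obtain ⟨s, rfl⟩ := Ideal.mem_span_singleton'.1 ha
  obtain ⟨r', hr'⟩ := exists_X_mul_eq_mul_X b
  exact Ideal.mem_span_singleton'.2 ⟨s * r', by rw [mul_assoc, mul_assoc, hr']⟩

theorem eq_X_of_X_mem_span {f : TwistedPolynomial σ} {m : ℕ} (hf : IsMonicOfDegree f m)
    (hirr : Irreducible f) (hX : SkewPolynomial.X ∈ Ideal.span {f}) : f = SkewPolynomial.X := by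
  rcases Nat.lt_trichotomy m 1 with hm | rfl | hm
  · obtain rfl : m = 0 := by omega
    exact absurd (hf.eq_one_of_zero ▸ isUnit_one) hirr.not_isUnit
  · refine (sub_eq_zero.1 (hf.isMinMonic_span.eq_zero _
      (sub_mem hX (Ideal.mem_span_singleton_self f)) (mem_degreeLT_of_succ ?_ ?_))).symm
    · exact sub_mem (fun i hi => SkewPolynomial.coeff_X_of_ne_one (by omega)) hf.mem
    · rw [SkewPolynomial.coeff_sub, hf.coeff, SkewPolynomial.coeff_X_one, sub_self]
  · exact absurd (hf.isMinMonic_span.eq_zero _ hX fun i hi =>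
      SkewPolynomial.coeff_X_of_ne_one (by omega)) SkewPolynomial.X_ne_zero

/-- Since `t R ⊆ R t`, the kernel of `t` is a submodule, hence zero or everything. -/
theorem X_smul_injective_of_isSimpleModule {V : Type*} [AddCommGroup V]
    [Module (TwistedPolynomial σ) V] [IsSimpleModule (TwistedPolynomial σ) V] {v₀ : V}
    (h₀ : (SkewPolynomial.X : TwistedPolynomial σ) • v₀ ≠ 0) {v : V}
    (hv : (SkewPolynomial.X : TwistedPolynomial σ) • v = 0) : v = 0 := by
  set N : Submodule (TwistedPolynomial σ) V :=
    { carrier := {v | (SkewPolynomial.X : TwistedPolynomial σ) • v = 0}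
      zero_mem' := smul_zero _
      add_mem' := fun {a b} ha hb => by
        change _ • _ = _
        rw [smul_add, show _ • a = 0 from ha, show _ • b = 0 from hb, add_zero]
      smul_mem' := fun r v hv => by
        obtain ⟨r', hr'⟩ := exists_X_mul_eq_mul_X r
        change _ • _ = _
        rw [smul_smul, hr', mul_smul, show _ • v = 0 from hv, smul_zero] } with hN
  rcases eq_bot_or_eq_top N with h | h
  · exact (Submodule.mem_bot _).1 (h ▸ (show v ∈ N from hv))
  · exact absurd (show v₀ ∈ N from h ▸ Submodule.mem_top) h₀

variable [FiniteDimensional F K]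

theorem exists_evalTPow_eq {c : TwistedPolynomial σ} {d : ℕ} (hc : IsMonicOfDegree c d)
    (hF : ∀ i, ∃ b : F, algebraMap F (TwistedCoeff σ) b = c.coeff i)
    (hdvd : ∀ i, c.coeff i ≠ 0 → Module.finrank F K ∣ i) :
    ∃ p : F[X], p.Monic ∧ evalTPow σ p = c ∧ d = Module.finrank F K * p.natDegree := by
  have hn : 0 < Module.finrank F K := Module.finrank_pos
  have hinj := (algebraMap F (TwistedCoeff σ)).injective
  choose b hb using hF
  obtain ⟨p, hp⟩ : ∃ p : F[X], ∀ i, p.coeff i = b (Module.finrank F K * i) := by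
    refine ⟨∑ j ∈ Finset.range (d + 1), Polynomial.monomial j (b (Module.finrank F K * j)),
      fun i => ?_⟩
    simp only [Polynomial.finsetSum_coeff, Polynomial.coeff_monomial, Finset.sum_ite_eq',
      Finset.mem_range]
    split_ifs with h
    · rfl
    · apply hinj
      rw [hb, map_zero, hc.mem]
      nlinarith
  obtain ⟨k, rfl⟩ := hdvd d (by rw [hc.coeff]; exact one_ne_zero)
  have hle : p.natDegree ≤ k := by
    rw [Polynomial.natDegree_le_iff_coeff_eq_zero]
    intro j hj
    apply hinj
    rw [hp, hb, map_zero, hc.mem]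
    exact Nat.mul_lt_mul_of_pos_left hj hn
  have hk : p.coeff k = 1 := by
    apply hinj
    rw [hp, hb, hc.coeff, map_one]
  refine ⟨p, Polynomial.monic_of_natDegree_le_of_coeff_eq_one k hle hk, ?_, ?_⟩
  · ext j
    rw [coeff_evalTPow]
    split_ifs with h
    · obtain ⟨i, rfl⟩ := h
      rw [Nat.mul_div_cancel_left _ hn, hp, hb]
    · by_contra h0
      exact h (hdvd j (Ne.symm h0))
  · rw [Polynomial.natDegree_eq_of_le_of_coeff_ne_zero hle (hk ▸ one_ne_zero)]

variable [IsGalois F K]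

theorem exists_eq_X_mul_add_C (p : TwistedPolynomial σ) :
    ∃ (r : TwistedPolynomial σ) (a : TwistedCoeff σ),
      p = SkewPolynomial.X * r + SkewPolynomial.C a := by
  induction p using SkewPolynomial.induction with
  | h0 => exact ⟨0, 0, by simp⟩
  | ha k a q _ _ ih =>
    obtain ⟨r, b, rfl⟩ := ih
    cases k with
    | zero => exact ⟨r, a + b, by
        rw [SkewPolynomial.monomial_zero_left, SkewPolynomial.C_add]; abel⟩
    | succ k =>
      -- Pulling `t` out on the left needs `σ⁻¹` on coefficients, and `σ⁻¹ = σⁿ⁻¹`.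
      refine ⟨SkewPolynomial.monomial k (φ^[Module.finrank F K - 1] a) + r, b, ?_⟩
      rw [mul_add, SkewPolynomial.X_mul_monomial, ← Function.iterate_succ_apply' φ,
        Nat.succ_eq_add_one, Nat.sub_add_cancel Module.finrank_pos, phi_iterate_finrank, add_assoc]

/-- A two-sided ideal in which `t` can be cancelled is generated by a central element. -/
theorem exists_evalTPow_eq_of_isMinMonic (hσ : ∀ τ : K ≃ₐ[F] K, τ ∈ Subgroup.zpowers σ)
    {I : Ideal (TwistedPolynomial σ)} [I.IsTwoSided]
    (hX : ∀ r : TwistedPolynomial σ, SkewPolynomial.X * r ∈ I → r ∈ I)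
    {c : TwistedPolynomial σ} {d : ℕ} (hc : IsMinMonic I c d) :
    ∃ p : F[X], p.Monic ∧ evalTPow σ p = c ∧ d = Module.finrank F K * p.natDegree := by
  have hcomm : ∀ (a : TwistedCoeff σ) (i : ℕ), c.coeff i * φ^[i] a = φ^[d] a * c.coeff i := by
    intro a i
    -- The leading terms cancel, leaving an element of `I` of degree below `d`.
    have h0 : c * SkewPolynomial.C a - SkewPolynomial.C (φ^[d] a) * c = 0 := by
      refine hc.eq_zero _ (sub_mem (I.mul_mem_right _ hc.mem) (I.mul_mem_left _ hc.mem)) ?_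
      intro j hj
      rw [SkewPolynomial.coeff_sub, SkewPolynomial.coeff_mul_C, C_mul_eq_smul, coeff_smul_apply,
        smul_eq_mul]
      rcases hj.eq_or_lt with rfl | hj
      · rw [hc.monic.coeff, mul_comm, sub_self]
      · rw [hc.monic.mem j hj, zero_mul, mul_zero, sub_self]
    rw [sub_eq_zero] at h0
    have := congr_arg (fun r => SkewPolynomial.coeff r i) h0
    simpa only [SkewPolynomial.coeff_mul_C, C_mul_eq_smul, coeff_smul_apply, smul_eq_mul] using this
  have hmod : ∀ i, c.coeff i ≠ 0 → i ≡ d [MOD Module.finrank F K] := by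
    intro i hi
    refine modEq_of_phi_iterate_eq hσ fun a => ?_
    have := hcomm a i
    rw [mul_comm] at this
    exact mul_right_cancel₀ hi this
  -- Otherwise `c = t r`, and cancelling `t` puts `r`, of smaller degree, in `I`. With `hmod` this
  -- makes every exponent in `c` divisible by `n`.
  have hc0 : c.coeff 0 ≠ 0 := by
    intro h0
    obtain ⟨r, a, hr⟩ := exists_eq_X_mul_add_C c
    have ha : a = 0 := by
      rw [hr, SkewPolynomial.coeff_add, SkewPolynomial.coeff_X_mul_zero, SkewPolynomial.coeff_C_zero,
        zero_add] at h0
      exact h0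
    rw [ha, SkewPolynomial.C_0, add_zero] at hr
    have hr0 : r = 0 := by
      refine hc.eq_zero r (hX r (hr ▸ hc.mem)) fun i hi => ?_
      have := hc.monic.mem (i + 1) (by omega)
      rw [hr, coeff_X_mul_succ] at this
      exact (map_eq_zero _).1 this
    have := hc.monic.coeff
    rw [hr, hr0, mul_zero] at this
    exact zero_ne_one this
  -- The commutator has degree at most `d`, so it equals `β c` for a constant `β`. Its constant term
  -- is `0 = β c₀`, so `β = 0`; commuting with `t` then puts the coefficients of `c` in `F`.
  have hXc : SkewPolynomial.X * c - c * SkewPolynomial.X = 0 := by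
    set e := SkewPolynomial.X * c - c * SkewPolynomial.X with he
    have heI : e ∈ I := sub_mem (I.mul_mem_left _ hc.mem) (I.mul_mem_right _ hc.mem)
    have hed : e ∈ SkewPolynomial.degreeLT (TwistedCoeff σ) (d + 1) := by
      intro i hi
      obtain ⟨i, rfl⟩ := Nat.exists_eq_add_of_le' (show 1 ≤ i by omega)
      rw [he, SkewPolynomial.coeff_sub, coeff_X_mul_succ, SkewPolynomial.coeff_mul_X_succ]
      rcases (show d ≤ i by omega).eq_or_lt with rfl | hi
      · rw [hc.monic.coeff, map_one, sub_self]
      · rw [hc.monic.mem i hi, map_zero, sub_self]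
    have h0 : e - SkewPolynomial.C (e.coeff d) * c = 0 := by
      refine hc.eq_zero _ (sub_mem heI (I.mul_mem_left _ hc.mem)) (mem_degreeLT_of_succ ?_ ?_)
      · rw [C_mul_eq_smul]
        exact sub_mem hed (Submodule.smul_mem _ _ hc.monic.mem)
      · rw [SkewPolynomial.coeff_sub, C_mul_eq_smul, coeff_smul_apply, hc.monic.coeff, smul_eq_mul,
          mul_one, sub_self]
    have he0 : e.coeff 0 = 0 := by
      rw [he, SkewPolynomial.coeff_sub, SkewPolynomial.coeff_X_mul_zero,
        SkewPolynomial.coeff_mul_X_zero, sub_self]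
    have hβ : SkewPolynomial.coeff e d = 0 := by
      have := congr_arg (fun r => SkewPolynomial.coeff r 0) h0
      simp only [SkewPolynomial.coeff_sub, C_mul_eq_smul, coeff_smul_apply, he0, zero_sub, smul_eq_mul,
        SkewPolynomial.coeff_zero, neg_eq_zero] at this
      exact (mul_eq_zero.1 this).resolve_right hc0
    rwa [hβ, SkewPolynomial.C_0, zero_mul, sub_zero] at h0
  refine exists_evalTPow_eq hc.monic (fun i => exists_algebraMap_eq hσ ?_) fun i hi => ?_
  · have := congr_arg (fun r => SkewPolynomial.coeff r (i + 1)) (sub_eq_zero.1 hXc)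
    simpa only [coeff_X_mul_succ, SkewPolynomial.coeff_mul_X_succ] using this
  · exact (Nat.modEq_zero_iff_dvd).1 ((hmod i hi).trans (hmod 0 hc0).symm)

end TwistedPolynomial

/-! ### Minimal central left multiples. -/

namespace TwistedPolynomial

open SkewPolynomial

variable {F K : Type*} [Field F] [Field K] [Algebra F K] {σ : K ≃ₐ[F] K}

theorem isCentralLeftMultiple_iff_mem {f : TwistedPolynomial σ} {p : F[X]} :
    IsCentralLeftMultiple f p ↔ evalTPow σ p ∈ Ideal.span {f} := by
  rw [Ideal.mem_span_singleton']
  exact exists_congr fun _ => eq_comm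

theorem isCentralLeftMultiple_of_smul_mk_one {f : TwistedPolynomial σ} {p : F[X]}
    (h : evalTPow σ p • (Submodule.Quotient.mk 1 : TwistedPolynomial σ ⧸ Ideal.span {f}) = 0) :
    IsCentralLeftMultiple f p := by
  rw [← Submodule.Quotient.mk_smul, Submodule.Quotient.mk_eq_zero, smul_eq_mul, mul_one] at h
  exact isCentralLeftMultiple_iff_mem.2 h

variable [FiniteDimensional F K]

theorem IsMclm.natDegree_le {f : TwistedPolynomial σ} {h p : F[X]} (hh : IsMclm f h)
    (hp : p.Monic) (hpf : IsCentralLeftMultiple f p) : h.natDegree ≤ p.natDegree := by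
  have := hh.minimal p hp hpf
  rw [natDegree_evalTPow hh.monic, natDegree_evalTPow hp] at this
  exact Nat.le_of_mul_le_mul_left this Module.finrank_pos

theorem IsMclm.dvd {f : TwistedPolynomial σ} {h p : F[X]} (hh : IsMclm f h)
    (hpf : IsCentralLeftMultiple f p) : h ∣ p := by
  rw [← Polynomial.modByMonic_eq_zero_iff_dvd hh.monic]
  by_contra h0
  set r := p %ₘ h with hr
  have hrf : evalTPow σ r ∈ Ideal.span {f} := by
    have hsum := Polynomial.modByMonic_add_div p h
    have hcomm : evalTPow σ (h * (p /ₘ h)) ∈ Ideal.span {f} := by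
      rw [mul_comm, evalTPow_mul]
      exact Ideal.mul_mem_left _ _ (isCentralLeftMultiple_iff_mem.1 hh.isCentralLeftMultiple)
    have hp := isCentralLeftMultiple_iff_mem.1 hpf
    rw [← hsum, evalTPow_add] at hp
    exact (Ideal.add_mem_iff_left _ hcomm).1 hp
  have hmonic := Polynomial.monic_mul_leadingCoeff_inv h0
  have hle := hh.natDegree_le hmonic (isCentralLeftMultiple_iff_mem.2 (by
    rw [mul_comm, evalTPow_mul]
    exact Ideal.mul_mem_left _ _ hrf))
  rw [Polynomial.natDegree_mul_leadingCoeff_inv _ h0] at hle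
  have hlt := Polynomial.degree_modByMonic_lt p hh.monic
  rw [← hr] at hlt
  exact absurd (Polynomial.natDegree_lt_natDegree h0 hlt) (by omega)

theorem IsMclm.unique {f : TwistedPolynomial σ} {h h' : F[X]} (hh : IsMclm f h)
    (hh' : IsMclm f h') : h = h' :=
  Polynomial.eq_of_monic_of_associated hh.monic hh'.monic
    (associated_of_dvd_dvd (hh.dvd hh'.isCentralLeftMultiple) (hh'.dvd hh.isCentralLeftMultiple))

theorem exists_isMclm_of_monic {f : TwistedPolynomial σ} {p : F[X]} (hp : p.Monic)
    (hpf : IsCentralLeftMultiple f p) : ∃ h, IsMclm f h := by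
  classical
  have hex : ∃ d, ∃ q : F[X], q.Monic ∧ IsCentralLeftMultiple f q ∧ q.natDegree = d :=
    ⟨_, p, hp, hpf, rfl⟩
  obtain ⟨h, hh, hhf, hd⟩ := Nat.find_spec hex
  refine ⟨h, hh, hhf, fun q hq hqf => ?_⟩
  rw [natDegree_evalTPow hh, natDegree_evalTPow hq, hd]
  exact Nat.mul_le_mul_left _ (Nat.find_min' hex ⟨q, hq, hqf, rfl⟩)

theorem exists_quotient_annihilator_equiv_of_isSimpleModule (V : Type*) [AddCommGroup V]
    [Module (TwistedPolynomial σ) V] [Module (TwistedCoeff σ) V]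
    [IsScalarTower (TwistedCoeff σ) (TwistedPolynomial σ) V] [Module.Finite (TwistedCoeff σ) V]
    [IsSimpleModule (TwistedPolynomial σ) V] :
    ∃ k : ℕ, Nonempty ((TwistedPolynomial σ ⧸ Module.annihilator (TwistedPolynomial σ) V)
      ≃ₗ[TwistedPolynomial σ] (Fin k → V)) := by
  set b := Module.finBasis (TwistedCoeff σ) V with hb
  set e := Module.finBasis F (TwistedCoeff σ) with he
  -- Elements of `R` act `F`-linearly but not `K`-linearly, so the detecting vectors must form an
  -- `F`-spanning set: products of an `F`-basis of `K` with a `K`-basis of `V`.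
  refine exists_quotient_annihilator_equiv (fun x : Fin _ × Fin _ => e x.1 • b x.2)
    fun r hr v => ?_
  have key : ∀ (a : TwistedCoeff σ) i, r • a • b i = 0 := by
    intro a i
    rw [← e.sum_repr a, Finset.sum_smul, Finset.smul_sum]
    refine Finset.sum_eq_zero fun j _ => ?_
    rw [Algebra.smul_def, mul_smul, ← SkewPolynomial.C_smul, smul_smul,
      ← (commute_C_algebraMap σ _ r).eq, mul_smul, hr (j, i), smul_zero]
  rw [← b.sum_repr v, Finset.smul_sum]
  exact Finset.sum_eq_zero fun i _ => key _ i

variable [IsGalois F K]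

theorem evalTPow_smul_mk {f : TwistedPolynomial σ} {p : F[X]}
    (hpf : IsCentralLeftMultiple f p) (v : TwistedPolynomial σ ⧸ Ideal.span {f}) :
    evalTPow σ p • v = 0 := by
  obtain ⟨r, rfl⟩ := Submodule.Quotient.mk_surjective _ v
  rw [← Submodule.Quotient.mk_smul, Submodule.Quotient.mk_eq_zero, smul_eq_mul,
    (evalTPow_commute σ p r).eq]
  exact Ideal.mul_mem_left _ _ (isCentralLeftMultiple_iff_mem.1 hpf)

/-- A monic polynomial of degree `m` has a central left multiple of degree `m * n`. -/
theorem exists_monic_isCentralLeftMultiple (hσ : ∀ τ : K ≃ₐ[F] K, τ ∈ Subgroup.zpowers σ)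
    {f : TwistedPolynomial σ} {m : ℕ} (hf : IsMonicOfDegree f m) :
    ∃ p : F[X], p.Monic ∧ p.natDegree = m ∧ IsCentralLeftMultiple f p ∧
      ∀ q : F[X], IsCentralLeftMultiple f q → p ∣ q ^ m := by
  have := hf.isMinMonic_span.finite_quotient
  obtain ⟨p, hp, hdeg, hchar⟩ :=
    exists_map_eq_charpoly σ (TwistedPolynomial σ ⧸ Ideal.span {f}) hσ
  rw [hf.isMinMonic_span.finrank_quotient] at hdeg
  refine ⟨p, hp, hdeg, isCentralLeftMultiple_of_smul_mk_one ?_, fun q hq => ?_⟩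
  · rw [← aeval_tPowEnd, hchar, LinearMap.aeval_self_charpoly, LinearMap.zero_apply]
  · have haeval : aeval (tPowEnd σ (TwistedPolynomial σ ⧸ Ideal.span {f}))
        (q.map (algebraMap F (TwistedCoeff σ))) = 0 := by
      refine LinearMap.ext fun v => ?_
      rw [aeval_tPowEnd, evalTPow_smul_mk hq, LinearMap.zero_apply]
    have hdvd := LinearMap.charpoly_dvd_pow_finrank _ haeval
    rw [hf.isMinMonic_span.finrank_quotient, ← hchar, ← Polynomial.map_pow] at hdvd
    exact (Polynomial.map_dvd_map' (algebraMap F (TwistedCoeff σ))).1 hdvd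

theorem existsUnique_isMclm (hσ : ∀ τ : K ≃ₐ[F] K, τ ∈ Subgroup.zpowers σ)
    {f : TwistedPolynomial σ} {m : ℕ} (hf : IsMonicOfDegree f m) : ∃! h, IsMclm f h := by
  obtain ⟨p, hp, -, hpf, -⟩ := exists_monic_isCentralLeftMultiple hσ hf
  obtain ⟨h, hh⟩ := exists_isMclm_of_monic hp hpf
  exact ⟨h, hh, fun _ hh' => hh'.unique hh⟩

theorem IsMclm.natDegree_le_of_isMonicOfDegree (hσ : ∀ τ : K ≃ₐ[F] K, τ ∈ Subgroup.zpowers σ)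
    {f : TwistedPolynomial σ} {m : ℕ} (hf : IsMonicOfDegree f m) {h : F[X]} (hh : IsMclm f h) :
    h.natDegree ≤ m := by
  obtain ⟨p, hp, rfl, hpf, -⟩ := exists_monic_isCentralLeftMultiple hσ hf
  exact hh.natDegree_le hp hpf

/-- The characteristic polynomial of `tⁿ` on `R/Rf` has degree `m` and divides `h ^ m`, so it is a
power of the irreducible `h`. -/
theorem IsMclm.natDegree_dvd (hσ : ∀ τ : K ≃ₐ[F] K, τ ∈ Subgroup.zpowers σ)
    {f : TwistedPolynomial σ} {m : ℕ} (hf : IsMonicOfDegree f m) {h : F[X]} (hh : IsMclm f h)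
    (hirr : Irreducible h) : h.natDegree ∣ m := by
  obtain ⟨p, hp, hdeg, -, hpow⟩ := exists_monic_isCentralLeftMultiple hσ hf
  obtain ⟨s, -, hs⟩ := (dvd_prime_pow hirr.prime m).1 (hpow h hh.isCentralLeftMultiple)
  rw [Polynomial.eq_of_monic_of_associated hp (hh.monic.pow s) hs,
    Polynomial.natDegree_pow] at hdeg
  exact ⟨s, by rw [← hdeg, mul_comm]⟩

/-- The minimal central left multiple of an irreducible polynomial is irreducible over `F`. -/
theorem IsMclm.irreducible {f : TwistedPolynomial σ} {m : ℕ} (hf : IsMonicOfDegree f m)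
    (hirr : Irreducible f) {h : F[X]} (hh : IsMclm f h) : Irreducible h := by
  have hsimple := isSimpleModule_quotient_span hf hirr
  have hne : h ≠ 1 := by
    rintro rfl
    have h1 := isCentralLeftMultiple_iff_mem.1 hh.isCentralLeftMultiple
    rw [evalTPow, Polynomial.eval₂_one] at h1
    have := IsSimpleModule.nontrivial (TwistedPolynomial σ) (TwistedPolynomial σ ⧸ Ideal.span {f})
    exact Submodule.Quotient.nontrivial_iff.1 this ((Ideal.eq_top_iff_one _).2 h1)
  rw [hh.monic.irreducible_iff_natDegree]
  refine ⟨hne, fun p q hp hq hpq => ?_⟩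
  -- The kernel of the central element `p(tⁿ)` contains the class of `q(tⁿ)`. By simplicity it is
  -- zero or everything, so `q` or `p` alone already gives a central left multiple of `f`.
  set N : Submodule (TwistedPolynomial σ) (TwistedPolynomial σ ⧸ Ideal.span {f}) :=
    { carrier := {v | evalTPow σ p • v = 0}
      zero_mem' := smul_zero _
      add_mem' := fun {a b} ha hb => by
        change _ • _ = _
        rw [smul_add, show _ • a = 0 from ha, show _ • b = 0 from hb, add_zero]
      smul_mem' := fun r v hv => by
        change _ • _ = _
        rw [smul_smul, (evalTPow_commute σ p r).eq, mul_smul, show _ • v = 0 from hv,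
          smul_zero] } with hN
  have hqN : evalTPow σ q • (Submodule.Quotient.mk 1) ∈ N := by
    change _ • _ = _
    rw [smul_smul, ← evalTPow_mul, hpq]
    exact evalTPow_smul_mk hh.isCentralLeftMultiple _
  have hdeg : p.natDegree + q.natDegree = h.natDegree := by
    rw [← hpq, hp.natDegree_mul hq]
  rcases eq_bot_or_eq_top N with hbot | htop
  · rw [hbot, Submodule.mem_bot] at hqN
    have := hh.natDegree_le hq (isCentralLeftMultiple_of_smul_mk_one hqN)
    omega
  · have h1 : Submodule.Quotient.mk 1 ∈ N := htop ▸ Submodule.mem_top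
    have := hh.natDegree_le hp (isCentralLeftMultiple_of_smul_mk_one h1)
    omega

/-- On a vector killed by `t`, the annihilating element `h(tⁿ)` acts as the nonzero constant `h(0)`.
-/
theorem eq_zero_of_X_smul_eq_zero {f : TwistedPolynomial σ} {h : F[X]} (hh : IsMclm f h)
    (h0 : h.coeff 0 ≠ 0) {v : TwistedPolynomial σ ⧸ Ideal.span {f}}
    (hv : (SkewPolynomial.X : TwistedPolynomial σ) • v = 0) : v = 0 := by
  have hkill := evalTPow_smul_mk hh.isCentralLeftMultiple v
  have hXp : evalTPow σ Polynomial.X • v = 0 := by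
    rw [evalTPow, Polynomial.eval₂_X, ← Nat.sub_add_cancel (Module.finrank_pos (R := F) (M := K)),
      pow_succ, mul_smul, hv, smul_zero]
  rw [← Polynomial.divX_mul_X_add h, evalTPow_add, add_smul, evalTPow_mul, mul_smul, hXp, smul_zero,
    zero_add, evalTPow, Polynomial.eval₂_C, RingHom.comp_apply, CRingHom_eq_C,
    SkewPolynomial.C_smul] at hkill
  rw [← inv_smul_smul₀ ((map_ne_zero (algebraMap F (TwistedCoeff σ))).2 h0) v, hkill, smul_zero]

/-- If `f` is right invariant and `ĥ(0) ≠ 0`, the minimal central left multiple is `f` itself. -/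
theorem IsMclm.finrank_mul_natDegree_le (hσ : ∀ τ : K ≃ₐ[F] K, τ ∈ Subgroup.zpowers σ)
    {f : TwistedPolynomial σ} {m : ℕ} (hf : IsMonicOfDegree f m) {h : F[X]} (hh : IsMclm f h)
    (h0 : h.coeff 0 ≠ 0) (hinv : RightInvariant f) : Module.finrank F K * h.natDegree ≤ m := by
  have : (Ideal.span {f}).IsTwoSided := hinv
  obtain ⟨p, hp, hpf, rfl⟩ := exists_evalTPow_eq_of_isMinMonic hσ (fun r hr => by
    rw [← Submodule.Quotient.mk_eq_zero]
    refine eq_zero_of_X_smul_eq_zero hh h0 ?_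
    rwa [← Submodule.Quotient.mk_smul, Submodule.Quotient.mk_eq_zero]) hf.isMinMonic_span
  refine Nat.mul_le_mul_left _ (hh.natDegree_le hp (isCentralLeftMultiple_iff_mem.2 ?_))
  rw [hpf]
  exact Ideal.mem_span_singleton_self f

/-- The degree of a non-invariant irreducible polynomial divides the degree of its minimal
central left multiple in `t`. -/
theorem IsMclm.dvd_finrank_mul_natDegree (hσ : ∀ τ : K ≃ₐ[F] K, τ ∈ Subgroup.zpowers σ)
    {f : TwistedPolynomial σ} {m : ℕ} (hf : IsMonicOfDegree f m) (hirr : Irreducible f)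
    (hinv : ¬ RightInvariant f) {h : F[X]} (hh : IsMclm f h) :
    m ∣ Module.finrank F K * h.natDegree := by
  have hsimple := isSimpleModule_quotient_span hf hirr
  have hfin := hf.isMinMonic_span.finite_quotient
  set V := TwistedPolynomial σ ⧸ Ideal.span {f} with hV
  -- Otherwise `t ∈ Rf`, so `f = t`, which is right invariant.
  have hX1 : (SkewPolynomial.X : TwistedPolynomial σ) • (Submodule.Quotient.mk 1 : V) ≠ 0 := by
    intro h1
    rw [← Submodule.Quotient.mk_smul, Submodule.Quotient.mk_eq_zero, smul_eq_mul, mul_one] at h1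
    exact hinv (eq_X_of_X_mem_span hf hirr h1 ▸ rightInvariant_X)
  set J := Module.annihilator (TwistedPolynomial σ) V with hJ
  have hhJ : evalTPow σ h ∈ J :=
    Module.mem_annihilator.2 (evalTPow_smul_mk hh.isCentralLeftMultiple)
  have hh0 : evalTPow σ h ≠ 0 := by
    intro h0
    have := (evalTPow_isMonicOfDegree σ hh.monic).coeff
    rw [h0] at this
    exact zero_ne_one this
  obtain ⟨d, c, hc⟩ := exists_isMinMonic ((Submodule.ne_bot_iff J).2 ⟨_, hhJ, hh0⟩)
  obtain ⟨p, hp, hpc, hd⟩ := exists_evalTPow_eq_of_isMinMonic hσ (fun r hr => by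
    rw [Module.mem_annihilator] at hr ⊢
    intro v
    refine X_smul_injective_of_isSimpleModule hX1 ?_
    rw [smul_smul]
    exact hr v) hc
  have hle : h.natDegree ≤ p.natDegree := by
    refine hh.natDegree_le hp (isCentralLeftMultiple_of_smul_mk_one ?_)
    rw [hpc]
    exact Module.mem_annihilator.1 hc.mem _
  have hge : d ≤ Module.finrank F K * h.natDegree := by
    by_contra hlt
    exact hh0 (hc.eq_zero _ hhJ (degreeLT_mono (by omega) (evalTPow_mem_degreeLT σ h)))
  have hdeq : d = Module.finrank F K * h.natDegree :=
    le_antisymm hge (hd ▸ Nat.mul_le_mul_left _ hle)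
  obtain ⟨k, ⟨e⟩⟩ := exists_quotient_annihilator_equiv_of_isSimpleModule (σ := σ) V
  -- Over `K`, the quotient `R/J` has dimension `d = n · deg h`, while `V^k` has dimension `k · m`.
  have hrank := (e.restrictScalars (TwistedCoeff σ)).finrank_eq
  rw [hc.finrank_quotient, Module.finrank_pi_fintype, Finset.sum_const, Finset.card_univ,
    Fintype.card_fin, hf.isMinMonic_span.finrank_quotient, smul_eq_mul] at hrank
  exact ⟨k, by rw [← hdeq, hrank, mul_comm]⟩

end TwistedPolynomial

theorem mainTheorem9 {F K : Type*} [Field F] [Field K] [Algebra F K] [FiniteDimensional F K]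
    [IsGalois F K] (σ : K ≃ₐ[F] K) (hσ : ∀ τ : K ≃ₐ[F] K, τ ∈ Subgroup.zpowers σ)
    (n : ℕ) (hn : Module.finrank F K = n) (hn1 : 1 < n)
    (m : ℕ) (f : TwistedPolynomial σ) (hf : TwistedPolynomial.Monic f)
    (hm : TwistedPolynomial.natDegree f = m) :
    -- the minimal central left multiple exists and is unique
    (∃! hhat : F[X], TwistedPolynomial.IsMclm f hhat) ∧
    -- `m * n` is an upper bound for its degree, over all monic polynomials of degree `m`
    (∀ (g : TwistedPolynomial σ) (ghat : F[X]), TwistedPolynomial.Monic g →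
      TwistedPolynomial.natDegree g = m → TwistedPolynomial.IsMclm g ghat →
        TwistedPolynomial.natDegree (TwistedPolynomial.evalTPow σ ghat) ≤ m * n) ∧
    (∀ hhat : F[X], TwistedPolynomial.IsMclm f hhat →
      -- part (i)
      (Irreducible f → ¬ TwistedPolynomial.RightInvariant f → Nat.gcd m n = 1 →
        TwistedPolynomial.natDegree (TwistedPolynomial.evalTPow σ hhat) = m * n ∧
        hhat.natDegree = m) ∧
      -- part (ii)
      (Nat.Prime m → (Irreducible f ∨ Irreducible hhat) →
        (∀ a : F, hhat ≠ Polynomial.X + Polynomial.C a) →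
        ¬ TwistedPolynomial.RightInvariant f ∧
        TwistedPolynomial.natDegree (TwistedPolynomial.evalTPow σ hhat) = m * n ∧
        hhat.natDegree = m)) := by
  subst hn
  have hfm : SkewPolynomial.IsMonicOfDegree f m := hm ▸ hf.isMonicOfDegree
  refine ⟨TwistedPolynomial.existsUnique_isMclm hσ hfm, fun g ghat hg hgm hgh => ?_,
    fun hhat hh => ⟨?_, ?_⟩⟩
  · rw [TwistedPolynomial.natDegree_evalTPow hgh.monic, mul_comm]
    exact Nat.mul_le_mul_right _
      (hgh.natDegree_le_of_isMonicOfDegree hσ (hgm ▸ hg.isMonicOfDegree))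
  · intro hirr hinv hgcd
    have hdeg : hhat.natDegree = m := by
      refine le_antisymm (hh.natDegree_le_of_isMonicOfDegree hσ hfm) ?_
      exact Nat.le_of_dvd (hh.irreducible hfm hirr).natDegree_pos
        (Nat.Coprime.dvd_of_dvd_mul_left hgcd (hh.dvd_finrank_mul_natDegree hσ hfm hirr hinv))
    exact ⟨by rw [TwistedPolynomial.natDegree_evalTPow hh.monic, hdeg, mul_comm], hdeg⟩
  · intro hprime hirr hlin
    have hhirr : Irreducible hhat := hirr.elim (hh.irreducible hfm) id
    have hdeg : hhat.natDegree = m := by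
      refine ((Nat.dvd_prime hprime).1 (hh.natDegree_dvd hσ hfm hhirr)).resolve_left fun h1 => ?_
      refine hlin (hhat.coeff 0) ?_
      conv_lhs => rw [hh.monic.eq_X_add_C h1]
    -- If `x` divides the irreducible monic `ĥ`, then `ĥ = x`, the excluded case `a = 0`.
    have h0 : hhat.coeff 0 ≠ 0 := by
      intro h0
      have hass := Polynomial.irreducible_X.associated_of_dvd hhirr (Polynomial.X_dvd_iff.2 h0)
      refine hlin 0 ?_
      rw [map_zero, add_zero]
      exact (Polynomial.eq_of_monic_of_associated Polynomial.monic_X hh.monic hass).symm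
    refine ⟨fun hinv => ?_, by rw [TwistedPolynomial.natDegree_evalTPow hh.monic, hdeg, mul_comm], hdeg⟩
    have hle := hh.finrank_mul_natDegree_le hσ hfm h0 hinv
    rw [hdeg] at hle
    have := hprime.pos
    nlinarith
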